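/- A deterministic two-party protocol is a binary tree whose internal nodes are labelled by Alice or Bob together with a function of that player's input giving the bit sent, and whose leaves are labelled by output bits; its cost is its height. For finite sets $X,Y$, $f\colon X\times Y\to\{0,1\}$, a probability distribution $\mu$ on $X\times Y$ and $\rho\in[0,1]$, let $C_\rho(f,\mu)$ be the least cost of a deterministic protocol whose output differs from $f(x,y)$ with probability at most $(1-\rho)/2$ when $(x,y)\sim\mu$. Let $f^{\oplus\ell}\colon X^\ell\times Y^\ell\to\{0,1\}$, $f^{\oplus\ell}(x,y)=f(x_1,y_1)\oplus\dots\oplus f(x_\ell,y_\ell)$, and let $\mu^{\otimes\ell}$ be the law of $\ell$ independent pairs $(x_i,y_i)\sim\mu$, regarded as a distribution on $X^\ell\times Y^\ell$. Let $\mathrm{EQ}_n\colon\{0,1\}^n\times\{0,1\}^n\to\{0,1\}$ be $1$ if $x=y$ and $0$ otherwise. Logarithms are to base $2$. Theorem. For every $\rho\in(0,1]$, $$\lim_{n\to\infty}\lim_{\ell\to\infty}\max_{\mu}\frac1\ell C_{\rho^\ell}\bigl(\mathrm{EQ}_n^{\oplus\ell},\mu^{\otimes\ell}\bigr)\ \ge\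 2\log 3+2\log\rho,$$ $$\lim_{n\to\infty}\lim_{\ell\to\infty}\max_{\nu}\frac1\ell C_{\rho^\ell}\bigl(\mathrm{EQ}_n^{\oplus\ell},(\nu^{\otimes n})^{\otimes\ell}\bigr)\ \ge\ 2\log\Bigl(1+\frac{2}{\sqrt3}\Bigr)+2\log\rho,$$ where $\mu$ and $\nu$ range over the probability distributions on $\{0,1\}^n\times\{0,1\}^n$ and on $\{0,1\}\times\{0,1\}$, respectively. Here the maxima are attained, the inner limits exist and are finite, and the outer limits exist in $[0,+\infty]$. -/

import Mathlib

open Filter Topology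

/-- Deterministic two-party communication protocols computing a bit, as binary trees: an internal
node belongs to Alice or to Bob, who sends one bit depending on her or his own input (and, through
the position in the tree, on the bits sent before); a leaf carries the output. The set `{0,1}` of
input and output bits is `ZMod 2`, so that XOR is addition. -/
inductive Protocol (X Y : Type) : Type
  | output (z : ZMod 2) : Protocol X Y
  | alice (a : X → Bool) (next : Bool → Protocol X Y) : Protocol X Y
  | bob (b : Y → Bool) (next : Bool → Protocol X Y) : Protocol X Y

namespace Protocol

variable {X Y : Type}

/-- The output of the protocol on the inputs `x` of Alice and `y` of Bob. -/
def run : Protocol X Y → X → Y → ZMod 2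
  | output z, _, _ => z
  | alice a next, x, y => (next (a x)).run x y
  | bob b next, x, y => (next (b y)).run x y

/-- The cost of the protocol: the largest number of bits exchanged (the height of the tree). -/
def cost : Protocol X Y → ℕ
  | output _ => 0
  | alice _ next => 1 + max (next false).cost (next true).cost
  | bob _ next => 1 + max (next false).cost (next true).cost

/-- The probability, under the input distribution `μ`, that the protocol errs on `f`. -/
noncomputable def errorProb [Fintype X] [Fintype Y] (P : Protocol X Y) (f : X → Y → ZMod 2)
    (μ : X × Y → ℝ) : ℝ :=
  ∑ p : X × Y, if P.run p.1 p.2 ≠ f p.1 p.2 then μ p else 0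

/-- Every function on finite sets is computed exactly by some protocol. -/
theorem exists_run_eq [Fintype X] [Fintype Y] (f : X → Y → ZMod 2) :
    ∃ P : Protocol X Y, ∀ x y, P.run x y = f x y := by
  classical
  have hY : ∀ (x₀ : X) (t : Finset Y), ∃ P : Protocol X Y, ∀ x, ∀ y ∈ t,
      P.run x y = f x₀ y := by
    intro x₀ t
    induction t using Finset.induction_on with
    | empty => exact ⟨output 0, by simp⟩
    | insert y₀ t _ ih =>
      obtain ⟨P, hP⟩ := ih
      refine ⟨bob (fun y => decide (y = y₀)) (fun c => if c then output (f x₀ y₀) else P), ?_⟩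
      intro x y hy
      by_cases h : y = y₀
      · subst h; simp [run]
      · simpa [run, h] using hP x y (Finset.mem_of_mem_insert_of_ne hy h)
  have hX : ∀ s : Finset X, ∃ P : Protocol X Y, ∀ x ∈ s, ∀ y, P.run x y = f x y := by
    intro s
    induction s using Finset.induction_on with
    | empty => exact ⟨output 0, by simp⟩
    | insert x₀ s _ ih =>
      obtain ⟨P, hP⟩ := ih
      obtain ⟨Q, hQ⟩ := hY x₀ Finset.univ
      refine ⟨alice (fun x => decide (x = x₀)) (fun c => if c then Q else P), ?_⟩
      intro x hx y
      by_cases h : x = x₀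
      · subst h; simpa [run] using hQ x y (Finset.mem_univ y)
      · simpa [run, h] using hP x (Finset.mem_of_mem_insert_of_ne hx h) y
  obtain ⟨P, hP⟩ := hX Finset.univ
  exact ⟨P, fun x y => hP x (Finset.mem_univ x) y⟩

end Protocol

/-- The distributional complexity `C_ρ(f, μ)`: the least cost of a deterministic protocol that
computes `f` with error probability at most `(1 - ρ) / 2` on the input distribution `μ`. -/
noncomputable def distComplexity {X Y : Type} [Fintype X] [Fintype Y] (ρ : ℝ)
    (f : X → Y → ZMod 2) (μ : X × Y → ℝ) : ℕ :=
  sInf {k : ℕ | ∃ P : Protocol X Y, P.cost = k ∧ P.errorProb f μ ≤ (1 - ρ) / 2}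

/-- For `ρ ≤ 1` the minimum in `distComplexity` is attained, so it is never a default value. -/
theorem exists_protocol_cost_eq_distComplexity {X Y : Type} [Fintype X] [Fintype Y] {ρ : ℝ}
    (hρ : ρ ≤ 1) (f : X → Y → ZMod 2) (μ : X × Y → ℝ) :
    ∃ P : Protocol X Y, P.cost = distComplexity ρ f μ ∧ P.errorProb f μ ≤ (1 - ρ) / 2 := by
  obtain ⟨P, hP⟩ := Protocol.exists_run_eq f
  have hne : {k : ℕ | ∃ P : Protocol X Y,
      P.cost = k ∧ P.errorProb f μ ≤ (1 - ρ) / 2}.Nonempty := by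
    refine ⟨P.cost, P, rfl, ?_⟩
    have h0 : P.errorProb f μ = 0 := by simp [Protocol.errorProb, hP]
    rw [h0]
    linarith
  exact Nat.sInf_mem hne

/-- The equality function `EQ_n` on `{0,1}^n × {0,1}^n`: `1` if `x = y` and `0` otherwise. -/
def eqFun (n : ℕ) (x y : Fin n → ZMod 2) : ZMod 2 :=
  if x = y then 1 else 0

/-- The XOR `f^{⊕ℓ}` of `ℓ` independent copies of `f`; each player's input is `ℓ` blocks. -/
def xorPow {X Y : Type} (f : X → Y → ZMod 2) (ℓ : ℕ) (x : Fin ℓ → X) (y : Fin ℓ → Y) : ZMod 2 :=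
  ∑ i, f (x i) (y i)

/-- The product distribution `μ^{⊗k}` of `k` independent copies of `μ`, on pairs of `k`-tuples. -/
def prodPow {X Y : Type} (μ : X × Y → ℝ) (k : ℕ) (p : (Fin k → X) × (Fin k → Y)) : ℝ :=
  ∏ i, μ (p.1 i, p.2 i)

/-! The lower bounds are spectral. Suppose the signed matrix `(-1)^f μ` has operator norm at most `c
/ |X|`. A protocol of cost `k` cuts the inputs into at most `2^k` rectangles of constant output, and
the entries of a matrix over `U × V` sum to at most its norm times `√(|U||V|)`; by Cauchy–Schwarz
the correlation is at most `c 2^(k/2)`. Norms multiply under tensor powers, so correlation `ρ^ℓ`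
with the XOR forces `ρ^ℓ ≤ c^ℓ 2^(k/2)`, which is `le_distComplexity_xorPow`. It remains to find
laws with small `c`. Mass `1/3` spread over the diagonal and `2/3` off it gives `c → 1/3`. For
product laws, take uniform bits agreeing with probability `q`, where `q^n → p`: after scaling, the
spectrum tends to lie in `[p² - 2p, 1 - 2p]`, and `p = 2 - √3` balances the two ends.

The inner limits exist by Fekete's lemma, since XORing protocols for two groups of blocks makes the
maximum subadditive. The outer limits exist because the inner ones are eventually monotone in `n`.
For arbitrary `μ` a fixed bit is prepended. For product laws the difficulty is to end with identical
factors: a shared random bit is prepended, and its certain agreement is then spread evenly over the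
positions by random maps that preserve equality (`exists_transfer_weights`). -/

/-- The sign `(-1)^z` of a bit. -/
def bitSign (z : ZMod 2) : ℝ := if z = 0 then 1 else -1

theorem ZMod.eq_zero_or_eq_one : ∀ z : ZMod 2, z = 0 ∨ z = 1 := by decide

@[simp] theorem bitSign_zero : bitSign 0 = 1 := by simp [bitSign]

@[simp] theorem bitSign_one : bitSign 1 = -1 := by simp [bitSign]

theorem bitSign_add (z w : ZMod 2) : bitSign (z + w) = bitSign z * bitSign w := by
  have h : (1 + 1 : ZMod 2) = 0 := by decide
  rcases ZMod.eq_zero_or_eq_one z with rfl | rfl <;>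
    rcases ZMod.eq_zero_or_eq_one w with rfl | rfl <;> simp [h]

theorem bitSign_sum {ι : Type*} (s : Finset ι) (z : ι → ZMod 2) :
    bitSign (∑ i ∈ s, z i) = ∏ i ∈ s, bitSign (z i) := by
  classical
  induction s using Finset.induction_on with
  | empty => simp
  | insert i s hi ih => rw [Finset.sum_insert hi, Finset.prod_insert hi, bitSign_add, ih]

theorem ite_ne_eq_bitSign (z w : ZMod 2) (m : ℝ) :
    (if z ≠ w then m else 0) = (m - bitSign z * bitSign w * m) / 2 := by
  rcases ZMod.eq_zero_or_eq_one z with rfl | rfl <;>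
    rcases ZMod.eq_zero_or_eq_one w with rfl | rfl <;> simp

/-! ### Operations on protocols, and correlation. -/

namespace Protocol

variable {X Y X' Y' : Type}

/-- The protocol run after both players have translated their inputs. -/
def comap (φ : X → X') (ψ : Y → Y') : Protocol X' Y' → Protocol X Y
  | output z => output z
  | alice a next => alice (fun x => a (φ x)) fun c => (next c).comap φ ψ
  | bob b next => bob (fun y => b (ψ y)) fun c => (next c).comap φ ψ

theorem run_comap (φ : X → X') (ψ : Y → Y') (P : Protocol X' Y') (x : X) (y : Y) :
    (P.comap φ ψ).run x y = P.run (φ x) (ψ y) := by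
  induction P with
  | output z => rfl
  | alice a next ih => simp [comap, run, ih]
  | bob b next ih => simp [comap, run, ih]

theorem cost_comap (φ : X → X') (ψ : Y → Y') (P : Protocol X' Y') :
    (P.comap φ ψ).cost = P.cost := by
  induction P with
  | output z => rfl
  | alice a next ih => simp [comap, cost, ih]
  | bob b next ih => simp [comap, cost, ih]

/-- Run `P`, then continue with the protocol assigned to its output. -/
def bind : Protocol X Y → (ZMod 2 → Protocol X Y) → Protocol X Y
  | output z, k => k z
  | alice a next, k => alice a fun c => (next c).bind k
  | bob b next, k => bob b fun c => (next c).bind k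

theorem run_bind (P : Protocol X Y) (k : ZMod 2 → Protocol X Y) (x : X) (y : Y) :
    (P.bind k).run x y = (k (P.run x y)).run x y := by
  induction P with
  | output z => rfl
  | alice a next ih => simp [bind, run, ih]
  | bob b next ih => simp [bind, run, ih]

theorem cost_bind_le (P : Protocol X Y) (k : ZMod 2 → Protocol X Y) {c : ℕ}
    (hk : ∀ z, (k z).cost ≤ c) : (P.bind k).cost ≤ P.cost + c := by
  induction P with
  | output z => simpa [bind, cost] using hk z
  | alice a next ih =>
    have h0 := ih false
    have h1 := ih true
    simp only [bind, cost]
    omega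
  | bob b next ih =>
    have h0 := ih false
    have h1 := ih true
    simp only [bind, cost]
    omega

/-- Run both protocols and output the XOR of their outputs. -/
def xor (P Q : Protocol X Y) : Protocol X Y :=
  P.bind fun z => Q.bind fun w => output (z + w)

theorem run_xor (P Q : Protocol X Y) (x : X) (y : Y) :
    (P.xor Q).run x y = P.run x y + Q.run x y := by
  simp [xor, run_bind, run]

theorem cost_xor_le (P Q : Protocol X Y) : (P.xor Q).cost ≤ P.cost + Q.cost :=
  cost_bind_le _ _ fun z => by
    simpa using cost_bind_le Q (fun w => output (z + w)) (c := 0) fun w => le_rfl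

/-- The correlation, under the input distribution `μ`, of the output of the protocol with `f`. -/
noncomputable def correlation [Fintype X] [Fintype Y] (P : Protocol X Y) (f : X → Y → ZMod 2)
    (μ : X × Y → ℝ) : ℝ :=
  ∑ p : X × Y, bitSign (P.run p.1 p.2) * bitSign (f p.1 p.2) * μ p

theorem errorProb_eq [Fintype X] [Fintype Y] (P : Protocol X Y) (f : X → Y → ZMod 2)
    {μ : X × Y → ℝ} (hμ : ∑ p, μ p = 1) : P.errorProb f μ = (1 - P.correlation f μ) / 2 := by
  simp only [errorProb, correlation, ite_ne_eq_bitSign]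
  rw [← Finset.sum_div, Finset.sum_sub_distrib, hμ]

theorem errorProb_le_iff [Fintype X] [Fintype Y] (P : Protocol X Y) (f : X → Y → ZMod 2)
    {μ : X × Y → ℝ} (hμ : ∑ p, μ p = 1) (σ : ℝ) :
    P.errorProb f μ ≤ (1 - σ) / 2 ↔ σ ≤ P.correlation f μ := by
  rw [P.errorProb_eq f hμ]
  constructor <;> intro h <;> linarith

end Protocol

/-! ### Subadditivity in the number of blocks, and reductions by public randomness. -/

section DistComplexity

variable {X Y X' Y' : Type} [Fintype X] [Fintype Y] [Fintype X'] [Fintype Y']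

theorem distComplexity_le_cost {σ : ℝ} {f : X → Y → ZMod 2} {μ : X × Y → ℝ} {P : Protocol X Y}
    (h : P.errorProb f μ ≤ (1 - σ) / 2) : distComplexity σ f μ ≤ P.cost :=
  Nat.sInf_le ⟨P, rfl, h⟩

theorem sum_pair_pi (k : ℕ) (g : (Fin k → X) × (Fin k → Y) → ℝ) :
    ∑ p, g p = ∑ r : Fin k → X × Y, g (fun i => (r i).1, fun i => (r i).2) :=
  (Fintype.sum_equiv (Equiv.arrowProdEquivProdArrow (Fin k) (fun _ => X) (fun _ => Y)) _ _
    fun _ => rfl).symm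

theorem sum_prod_pair (k : ℕ) (g : X × Y → ℝ) :
    ∑ p : (Fin k → X) × (Fin k → Y), ∏ i, g (p.1 i, p.2 i) = (∑ p, g p) ^ k := by
  classical
  rw [sum_pair_pi, Fintype.sum_pow]

theorem sum_prodPow (μ : X × Y → ℝ) (k : ℕ) : ∑ p, prodPow μ k p = (∑ p, μ p) ^ k :=
  sum_prod_pair k μ

theorem prodPow_mem_stdSimplex {μ : X × Y → ℝ} (hμ : μ ∈ stdSimplex ℝ (X × Y)) (k : ℕ) :
    prodPow μ k ∈ stdSimplex ℝ ((Fin k → X) × (Fin k → Y)) :=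
  ⟨fun _ => Finset.prod_nonneg fun _ _ => hμ.1 _, by rw [sum_prodPow, hμ.2, one_pow]⟩

theorem Protocol.correlation_xor (P : Protocol X Y) (Q : Protocol X' Y') (f : X → Y → ZMod 2)
    (g : X' → Y' → ZMod 2) (μ : X × Y → ℝ) (ν : X' × Y' → ℝ) :
    (∑ p : X × Y, ∑ q : X' × Y', bitSign (P.run p.1 p.2 + Q.run q.1 q.2) *
      bitSign (f p.1 p.2 + g q.1 q.2) * (μ p * ν q)) =
      P.correlation f μ * Q.correlation g ν := by
  rw [Protocol.correlation, Protocol.correlation, Finset.sum_mul_sum]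
  refine Finset.sum_congr rfl fun p _ => Finset.sum_congr rfl fun q _ => ?_
  rw [bitSign_add, bitSign_add]
  ring

/-- Splitting `a + b` blocks of inputs into the first `a` and the last `b`. -/
def splitInputs (X Y : Type) (a b : ℕ) :
    ((Fin a → X) × (Fin a → Y)) × ((Fin b → X) × (Fin b → Y)) ≃
      (Fin (a + b) → X) × (Fin (a + b) → Y) :=
  (Equiv.prodProdProdComm _ _ _ _).trans
    (Equiv.prodCongr (Fin.appendEquiv a b) (Fin.appendEquiv a b))

/-- XOR the outputs of optimal protocols for the two groups of blocks: by independence the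
correlations multiply while the costs add. -/
theorem distComplexity_add_le {ρ : ℝ} (hρ0 : 0 ≤ ρ) (hρ1 : ρ ≤ 1) (f : X → Y → ZMod 2)
    {μ : X × Y → ℝ} (hμ : μ ∈ stdSimplex ℝ (X × Y)) (a b : ℕ) :
    distComplexity (ρ ^ (a + b)) (xorPow f (a + b)) (prodPow μ (a + b)) ≤
      distComplexity (ρ ^ a) (xorPow f a) (prodPow μ a) +
        distComplexity (ρ ^ b) (xorPow f b) (prodPow μ b) := by
  have hsum (k : ℕ) : ∑ p, prodPow μ k p = 1 := (prodPow_mem_stdSimplex hμ k).2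
  obtain ⟨P, hP, hPe⟩ := exists_protocol_cost_eq_distComplexity
    (pow_le_one₀ hρ0 hρ1 : ρ ^ a ≤ 1) (xorPow f a) (prodPow μ a)
  obtain ⟨Q, hQ, hQe⟩ := exists_protocol_cost_eq_distComplexity
    (pow_le_one₀ hρ0 hρ1 : ρ ^ b ≤ 1) (xorPow f b) (prodPow μ b)
  rw [Protocol.errorProb_le_iff _ _ (hsum _)] at hPe hQe
  set R : Protocol (Fin (a + b) → X) (Fin (a + b) → Y) :=
    (P.comap (fun x i => x (Fin.castAdd b i)) fun y i => y (Fin.castAdd b i)).xor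
      (Q.comap (fun x i => x (Fin.natAdd a i)) fun y i => y (Fin.natAdd a i)) with hR
  have hcost : R.cost ≤ P.cost + Q.cost := by
    simpa only [Protocol.cost_comap] using Protocol.cost_xor_le
      (P.comap (fun x i => x (Fin.castAdd b i)) fun y i => y (Fin.castAdd b i))
      (Q.comap (fun (x : Fin (a + b) → X) i => x (Fin.natAdd a i))
        fun (y : Fin (a + b) → Y) i => y (Fin.natAdd a i))
  have hcorr : R.correlation (xorPow f (a + b)) (prodPow μ (a + b)) =
      P.correlation (xorPow f a) (prodPow μ a) * Q.correlation (xorPow f b) (prodPow μ b) := by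
    rw [← Protocol.correlation_xor, ← Fintype.sum_prod_type', Protocol.correlation]
    refine (Fintype.sum_equiv (splitInputs X Y a b) _ _ fun p => ?_).symm
    obtain ⟨⟨x, y⟩, x', y'⟩ := p
    simp [hR, splitInputs, Protocol.run_xor, Protocol.run_comap, xorPow, prodPow,
      Fin.sum_univ_add, Fin.prod_univ_add]
  rw [← hP, ← hQ]
  refine (distComplexity_le_cost ?_).trans hcost
  rw [Protocol.errorProb_le_iff _ _ (hsum _), hcorr, pow_add]
  exact mul_le_mul hPe hQe (pow_nonneg hρ0 _) ((pow_nonneg hρ0 _).trans hPe)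

/-- `μ'` is the law of the pair obtained from `(x, y) ∼ μ` when the players use public randomness
`r`, drawn with the weights `w`, to replace `x` by `φ r x` and `y` by `ψ r y`. -/
def IsRandomImage {ι : Type} [Fintype ι] (w : ι → ℝ) (φ : ι → X → X') (ψ : ι → Y → Y')
    (μ : X × Y → ℝ) (μ' : X' × Y' → ℝ) : Prop :=
  ∀ g : X' × Y' → ℝ, ∑ z, μ' z * g z = ∑ r, w r * ∑ p, μ p * g (φ r p.1, ψ r p.2)

theorem isRandomImage_iff [DecidableEq X'] [DecidableEq Y'] {ι : Type} [Fintype ι] {w : ι → ℝ}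
    {φ : ι → X → X'} {ψ : ι → Y → Y'} {μ : X × Y → ℝ} {μ' : X' × Y' → ℝ} :
    IsRandomImage w φ ψ μ μ' ↔
      ∀ z, μ' z = ∑ r, w r * ∑ p, if (φ r p.1, ψ r p.2) = z then μ p else 0 := by
  constructor
  · intro h z
    simpa using h fun z' => if z' = z then 1 else 0
  · intro h g
    simp_rw [h, Finset.sum_mul, Finset.mul_sum, Finset.sum_mul]
    rw [Finset.sum_comm]
    refine Finset.sum_congr rfl fun r _ => ?_
    rw [Finset.sum_comm]
    refine Finset.sum_congr rfl fun p _ => ?_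
    simp [mul_assoc]

theorem IsRandomImage.prodPow {ι : Type} [Fintype ι] {w : ι → ℝ}
    {φ : ι → X → X'} {ψ : ι → Y → Y'} {μ : X × Y → ℝ} {μ' : X' × Y' → ℝ}
    (h : IsRandomImage w φ ψ μ μ') (k : ℕ) :
    IsRandomImage (fun r : Fin k → ι => ∏ i, w (r i)) (fun r x i => φ (r i) (x i))
      (fun r y i => ψ (r i) (y i)) (prodPow μ k) (prodPow μ' k) := by
  classical
  rw [isRandomImage_iff] at h ⊢
  intro z
  simp only [_root_.prodPow, h]
  simp only [Finset.mul_sum]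
  simp only [← Fintype.sum_prod_type' (f := fun r (p : X × Y) => w r * _)]
  rw [Finset.prod_univ_sum, Fintype.piFinset_univ, ← Fintype.sum_prod_type']
  refine Fintype.sum_equiv ((Equiv.arrowProdEquivProdArrow (Fin k) (fun _ => ι)
    (fun _ => X × Y)).trans (Equiv.prodCongr (Equiv.refl _)
      (Equiv.arrowProdEquivProdArrow (Fin k) (fun _ => X) (fun _ => Y)))) _ _ fun r => ?_
  simp only [Finset.prod_mul_distrib]
  congr 1
  simp only [Equiv.trans_apply, Equiv.prodCongr_apply, Equiv.arrowProdEquivProdArrow,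
    Equiv.coe_fn_mk, Prod.map, Equiv.refl_apply, Finset.prod_ite_zero]
  have hz : (∀ i ∈ Finset.univ, (φ (r i).1 (r i).2.1, ψ (r i).1 (r i).2.2) = (z.1 i, z.2 i)) ↔
      ((fun i => φ (r i).1 (r i).2.1, fun i => ψ (r i).1 (r i).2.2) = z) := by
    simp [Prod.ext_iff, funext_iff, forall_and]
  split_ifs with h₁ h₂ h₂
  · rfl
  · exact absurd (hz.1 h₁) h₂
  · exact absurd (hz.2 h₂) h₁
  · rfl

/-- The error of a protocol under `μ'` is the `w`-average of the errors of its translates under `μ`,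
so some fixed value of the randomness does at least as well. -/
theorem IsRandomImage.distComplexity_le {ι : Type} [Fintype ι] {w : ι → ℝ} (hw : w ∈ stdSimplex ℝ ι)
    {φ : ι → X → X'} {ψ : ι → Y → Y'} {μ : X × Y → ℝ} {μ' : X' × Y' → ℝ}
    (h : IsRandomImage w φ ψ μ μ') {σ : ℝ} (hσ : σ ≤ 1) {f : X → Y → ZMod 2}
    {f' : X' → Y' → ZMod 2} (hf : ∀ r x y, f' (φ r x) (ψ r y) = f x y) :
    distComplexity σ f μ ≤ distComplexity σ f' μ' := by
  obtain ⟨P, hP, hPe⟩ := exists_protocol_cost_eq_distComplexity hσ f' μ'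
  have key : P.errorProb f' μ' = ∑ r, w r * (P.comap (φ r) (ψ r)).errorProb f μ := by
    simpa [Protocol.errorProb, Protocol.run_comap, hf] using
      h fun z => if P.run z.1 z.2 ≠ f' z.1 z.2 then 1 else 0
  obtain ⟨r, hr⟩ : ∃ r, (P.comap (φ r) (ψ r)).errorProb f μ ≤ (1 - σ) / 2 := by
    by_contra! hlt
    obtain ⟨r₀, hr₀⟩ : ∃ r, 0 < w r := by
      by_contra! hneg
      have := Finset.sum_nonpos fun r (_ : r ∈ Finset.univ) => hneg r
      linarith [hw.2]
    have : ∑ r, w r * ((1 - σ) / 2) < ∑ r, w r * (P.comap (φ r) (ψ r)).errorProb f μ :=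
      Finset.sum_lt_sum (fun r _ => mul_le_mul_of_nonneg_left (hlt r).le (hw.1 r))
        ⟨r₀, Finset.mem_univ _, mul_lt_mul_of_pos_left (hlt r₀) hr₀⟩
    rw [← Finset.sum_mul, hw.2, ← key] at this
    linarith
  calc distComplexity σ f μ ≤ (P.comap (φ r) (ψ r)).cost := distComplexity_le_cost hr
    _ = _ := by rw [Protocol.cost_comap, hP]

theorem prod_mem_stdSimplex {ι : Type} [Fintype ι] {w : ι → ℝ} (hw : w ∈ stdSimplex ℝ ι) (k : ℕ) :
    (fun r : Fin k → ι => ∏ i, w (r i)) ∈ stdSimplex ℝ (Fin k → ι) := by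
  classical
  refine ⟨fun _ => Finset.prod_nonneg fun _ _ => hw.1 _, ?_⟩
  rw [← Fintype.sum_pow, hw.2, one_pow]

theorem IsRandomImage.distComplexity_xorPow_le {ι : Type} [Fintype ι] {w : ι → ℝ}
    (hw : w ∈ stdSimplex ℝ ι) {φ : ι → X → X'} {ψ : ι → Y → Y'} {μ : X × Y → ℝ}
    {μ' : X' × Y' → ℝ} (h : IsRandomImage w φ ψ μ μ') {σ : ℝ} (hσ : σ ≤ 1) {f : X → Y → ZMod 2}
    {f' : X' → Y' → ZMod 2} (hf : ∀ r x y, f' (φ r x) (ψ r y) = f x y) (ℓ : ℕ) :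
    distComplexity σ (xorPow f ℓ) (_root_.prodPow μ ℓ) ≤
      distComplexity σ (xorPow f' ℓ) (_root_.prodPow μ' ℓ) :=
  (h.prodPow ℓ).distComplexity_le (prod_mem_stdSimplex hw ℓ) hσ fun r x y => by
    simp [xorPow, hf]

theorem IsRandomImage.sum_eq {ι : Type} [Fintype ι] {w : ι → ℝ} (hw : w ∈ stdSimplex ℝ ι)
    {φ : ι → X → X'} {ψ : ι → Y → Y'} {μ : X × Y → ℝ} {μ' : X' × Y' → ℝ}
    (h : IsRandomImage w φ ψ μ μ') : ∑ z, μ' z = ∑ p, μ p := by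
  have := h fun _ => 1
  simpa [← Finset.sum_mul, hw.2] using this

end DistComplexity

/-! ### The spectral lower bound. -/

section OperatorBound

variable {X Y X' Y' : Type} [Fintype X] [Fintype Y] [Fintype X'] [Fintype Y']

/-- The real matrix `M` has operator norm at most `|c|`. -/
def HasOpBound (M : X → Y → ℝ) (c : ℝ) : Prop :=
  ∀ v : Y → ℝ, ∑ x, (∑ y, M x y * v y) ^ 2 ≤ c ^ 2 * ∑ y, v y ^ 2

theorem sum_pi_succ (k : ℕ) (g : (Fin (k + 1) → X) → ℝ) :
    ∑ x, g x = ∑ a, ∑ x : Fin k → X, g (Fin.cons a x) := by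
  rw [← Fintype.sum_prod_type']
  exact (Fintype.sum_equiv (Fin.consEquiv fun _ => X) _ _ fun _ => rfl).symm

/-- A tensor product acts one coordinate at a time: `M` on the first, the inductive bound on the
rest. -/
theorem HasOpBound.pow {M : X → Y → ℝ} {c : ℝ} (h : HasOpBound M c) (k : ℕ) :
    HasOpBound (fun (x : Fin k → X) (y : Fin k → Y) => ∏ i, M (x i) (y i)) (c ^ k) := by
  induction k with
  | zero => intro v; simp
  | succ k ih =>
    intro v
    simp only [sum_pi_succ, Fin.prod_univ_succ, Fin.cons_zero, Fin.cons_succ, mul_assoc,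
      ← Finset.mul_sum]
    calc _ = ∑ x' : Fin k → X, ∑ x : X, (∑ y, M x y *
            ∑ y' : Fin k → Y, (∏ i, M (x' i) (y' i)) * v (Fin.cons y y')) ^ 2 :=
          Finset.sum_comm
      _ ≤ ∑ x' : Fin k → X, c ^ 2 * ∑ y,
            (∑ y' : Fin k → Y, (∏ i, M (x' i) (y' i)) * v (Fin.cons y y')) ^ 2 :=
          Finset.sum_le_sum fun x' _ => h _
      _ = c ^ 2 * ∑ y, ∑ x' : Fin k → X,
            (∑ y' : Fin k → Y, (∏ i, M (x' i) (y' i)) * v (Fin.cons y y')) ^ 2 := by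
          rw [← Finset.mul_sum, Finset.sum_comm]
      _ ≤ c ^ 2 * ∑ y, (c ^ k) ^ 2 * ∑ y' : Fin k → Y, v (Fin.cons y y') ^ 2 := by
          gcongr with y
          exact ih _
      _ = _ := by rw [← Finset.mul_sum]; ring

theorem HasOpBound.abs_sum_rectangle_le {M : X → Y → ℝ} {c : ℝ} (hc : 0 ≤ c)
    (h : HasOpBound M c) (U : Finset X) (V : Finset Y) :
    |∑ x ∈ U, ∑ y ∈ V, M x y| ≤ c * √(U.card * V.card) := by
  classical
  have h1 : ∑ x, (∑ y ∈ V, M x y) ^ 2 ≤ c ^ 2 * V.card := by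
    simpa [Finset.sum_ite_mem] using h fun y => if y ∈ V then 1 else 0
  have h2 : (∑ x ∈ U, ∑ y ∈ V, M x y) ^ 2 ≤ U.card * ∑ x ∈ U, (∑ y ∈ V, M x y) ^ 2 :=
    sq_sum_le_card_mul_sum_sq
  have h3 : ∑ x ∈ U, (∑ y ∈ V, M x y) ^ 2 ≤ ∑ x, (∑ y ∈ V, M x y) ^ 2 :=
    Finset.sum_le_univ_sum_of_nonneg fun x => sq_nonneg _
  rw [← abs_of_nonneg hc, ← Real.sqrt_sq_eq_abs c, ← Real.sqrt_mul (sq_nonneg c)]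
  refine Real.abs_le_sqrt (h2.trans ?_)
  calc _ ≤ (U.card : ℝ) * (c ^ 2 * V.card) := by gcongr; exact h3.trans h1
    _ = _ := by ring

/-- One communicated bit costs a factor `√2`, since `√m + √n ≤ √2 √(m + n)` when a rectangle of area
`m + n` is split in two. -/
theorem abs_add_le_of_sqrt_bounds {c s t m n : ℝ} (hc : 0 ≤ c) (hm : 0 ≤ m) (hn : 0 ≤ n) {a b : ℕ}
    (hs : |s| ≤ c * √2 ^ a * √m) (ht : |t| ≤ c * √2 ^ b * √n) :
    |s + t| ≤ c * √2 ^ (1 + max a b) * √(m + n) := by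
  have h2 : (1 : ℝ) ≤ √2 := Real.one_le_sqrt.2 (by norm_num)
  have key : √m + √n ≤ √2 * √(m + n) := by
    rw [← Real.sqrt_mul (by norm_num)]
    refine Real.le_sqrt_of_sq_le ?_
    nlinarith [sq_nonneg (√m - √n), Real.sq_sqrt hm, Real.sq_sqrt hn]
  calc |s + t| ≤ |s| + |t| := abs_add_le _ _
    _ ≤ c * √2 ^ max a b * √m + c * √2 ^ max a b * √n := by
        refine add_le_add (hs.trans ?_) (ht.trans ?_) <;> gcongr <;> simp
    _ = c * √2 ^ max a b * (√m + √n) := by ring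
    _ ≤ c * √2 ^ max a b * (√2 * √(m + n)) := by gcongr
    _ = _ := by ring

theorem Protocol.abs_sum_le (P : Protocol X Y) {M : X → Y → ℝ} {c : ℝ} (hc : 0 ≤ c)
    (h : HasOpBound M c) (U : Finset X) (V : Finset Y) :
    |∑ x ∈ U, ∑ y ∈ V, bitSign (P.run x y) * M x y| ≤
      c * √2 ^ P.cost * √(U.card * V.card) := by
  induction P generalizing U V with
  | output z =>
    simp only [Protocol.run, Protocol.cost, ← Finset.mul_sum, abs_mul, pow_zero, mul_one]
    have hz : |bitSign z| = 1 := by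
      rcases ZMod.eq_zero_or_eq_one z with rfl | rfl <;> simp
    rw [hz, one_mul]
    exact h.abs_sum_rectangle_le hc U V
  | alice a next ih =>
    have hF := ih false (U.filter fun x => ¬ a x = true) V
    have hT := ih true (U.filter fun x => a x = true) V
    have hcard : (((U.filter fun x => ¬ a x = true).card : ℝ) * V.card +
        (U.filter fun x => a x = true).card * V.card) = U.card * V.card := by
      rw [← add_mul, ← Finset.card_filter_add_card_filter_not (s := U) (fun x => a x = true)]
      push_cast
      ring
    have hsum := Finset.sum_filter_add_sum_filter_not U (fun x => a x = true)
      fun x => ∑ y ∈ V, bitSign ((Protocol.alice a next).run x y) * M x y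
    have hsT : ∑ x ∈ U.filter (fun x => a x = true), ∑ y ∈ V,
        bitSign ((Protocol.alice a next).run x y) * M x y =
        ∑ x ∈ U.filter (fun x => a x = true), ∑ y ∈ V,
          bitSign ((next true).run x y) * M x y :=
      Finset.sum_congr rfl fun x hx => by simp [Protocol.run, (Finset.mem_filter.1 hx).2]
    have hsF : ∑ x ∈ U.filter (fun x => ¬ a x = true), ∑ y ∈ V,
        bitSign ((Protocol.alice a next).run x y) * M x y =
        ∑ x ∈ U.filter (fun x => ¬ a x = true), ∑ y ∈ V,
          bitSign ((next false).run x y) * M x y :=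
      Finset.sum_congr rfl fun x hx => by
        simp [Protocol.run, Bool.eq_false_iff.2 (Finset.mem_filter.1 hx).2]
    rw [← hsum, hsT, hsF, add_comm, ← hcard]
    exact abs_add_le_of_sqrt_bounds hc (by positivity) (by positivity) hF hT
  | bob b next ih =>
    have hF := ih false U (V.filter fun y => ¬ b y = true)
    have hT := ih true U (V.filter fun y => b y = true)
    have hcard : ((U.card : ℝ) * (V.filter fun y => ¬ b y = true).card +
        U.card * (V.filter fun y => b y = true).card) = U.card * V.card := by
      rw [← mul_add, ← Finset.card_filter_add_card_filter_not (s := V) (fun y => b y = true)]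
      push_cast
      ring
    have hsum : ∑ x ∈ U, ∑ y ∈ V, bitSign ((Protocol.bob b next).run x y) * M x y =
        ∑ x ∈ U, ∑ y ∈ V.filter (fun y => ¬ b y = true), bitSign ((next false).run x y) * M x y +
        ∑ x ∈ U, ∑ y ∈ V.filter (fun y => b y = true),
          bitSign ((next true).run x y) * M x y := by
      rw [← Finset.sum_add_distrib]
      refine Finset.sum_congr rfl fun x _ => ?_
      rw [← Finset.sum_filter_add_sum_filter_not V (fun y => b y = true), add_comm]
      congr 1
      · exact Finset.sum_congr rfl fun y hy => by
          simp [Protocol.run, Bool.eq_false_iff.2 (Finset.mem_filter.1 hy).2]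
      · exact Finset.sum_congr rfl fun y hy => by
          simp [Protocol.run, (Finset.mem_filter.1 hy).2]
    rw [hsum, ← hcard]
    exact abs_add_le_of_sqrt_bounds hc (by positivity) (by positivity) hF hT

/-- The spectral lower bound on the cost of computing the XOR of independent copies. -/
theorem le_distComplexity_xorPow [Nonempty X] {f : X → X → ZMod 2} {μ : X × X → ℝ}
    (hμ : μ ∈ stdSimplex ℝ (X × X)) {c ρ : ℝ} (hc : 0 < c) (hρ0 : 0 < ρ) (hρ1 : ρ ≤ 1)
    (h : HasOpBound (fun x y => bitSign (f x y) * μ (x, y)) (c / Fintype.card X)) {ℓ : ℕ}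
    (hℓ : ℓ ≠ 0) :
    2 * Real.logb 2 ρ - 2 * Real.logb 2 c ≤
      1 / (ℓ : ℝ) * (distComplexity (ρ ^ ℓ) (xorPow f ℓ) (prodPow μ ℓ) : ℝ) := by
  classical
  obtain ⟨P, hP, hPe⟩ := exists_protocol_cost_eq_distComplexity
    (pow_le_one₀ hρ0.le hρ1 : ρ ^ ℓ ≤ 1) (xorPow f ℓ) (prodPow μ ℓ)
  rw [Protocol.errorProb_le_iff _ _ (prodPow_mem_stdSimplex hμ ℓ).2] at hPe
  have hN : (0 : ℝ) < Fintype.card X := by exact_mod_cast Fintype.card_pos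
  have hsum := P.abs_sum_le (by positivity) (h.pow ℓ) Finset.univ Finset.univ
  have hcorr : P.correlation (xorPow f ℓ) (prodPow μ ℓ) = ∑ x, ∑ y, bitSign (P.run x y) *
      ∏ i, bitSign (f (x i) (y i)) * μ (x i, y i) := by
    rw [Protocol.correlation, Fintype.sum_prod_type]
    refine Finset.sum_congr rfl fun x _ => Finset.sum_congr rfl fun y _ => ?_
    rw [xorPow, bitSign_sum, prodPow, Finset.prod_mul_distrib, mul_assoc]
  have hle : ρ ^ ℓ ≤ c ^ ℓ * √2 ^ P.cost := by
    refine hPe.trans ((le_abs_self _).trans ?_)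
    rw [hcorr]
    refine hsum.trans_eq ?_
    have hcard : (Fintype.card (Fin ℓ → X) : ℝ) = (Fintype.card X : ℝ) ^ ℓ := by simp
    rw [Finset.card_univ, Real.sqrt_mul_self (by positivity), hcard, div_pow]
    field_simp
  have hlog := Real.logb_le_logb_of_le (b := 2) (by norm_num) (by positivity) hle
  have hs2 : Real.logb 2 √2 = 1 / 2 := by
    rw [Real.sqrt_eq_rpow, Real.logb_rpow] <;> norm_num
  rw [Real.logb_mul (by positivity) (by positivity), Real.logb_pow, Real.logb_pow,
    Real.logb_pow, hs2, hP] at hlog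
  have hℓ' : (0 : ℝ) < ℓ := by positivity
  rw [one_div, ← div_eq_inv_mul, le_div_iff₀ hℓ']
  linarith

end OperatorBound

/-! ### Maxima and iterated limits. -/

section Limits

theorem exists_limit_max_distComplexity {ι X : Type} [Fintype X] {ρ : ℝ} (hρ0 : 0 ≤ ρ)
    (hρ1 : ρ ≤ 1) (f : X → X → ZMod 2) {S : Set ι} (hS : S.Nonempty) {D : ι → X × X → ℝ}
    (hD : ∀ i ∈ S, D i ∈ stdSimplex ℝ (X × X)) :
    ∃ (M : ℕ → ℝ) (L : ℝ),
      (∀ ℓ : ℕ, IsGreatest {c : ℝ | ∃ i ∈ S,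
        c = 1 / (ℓ : ℝ) * (distComplexity (ρ ^ ℓ) (xorPow f ℓ) (prodPow (D i) ℓ) : ℝ)} (M ℓ)) ∧
      Tendsto M atTop (𝓝 L) := by
  set C : ι → ℕ → ℕ := fun i ℓ => distComplexity (ρ ^ ℓ) (xorPow f ℓ) (prodPow (D i) ℓ) with hC
  -- No compactness is needed: the costs are integers, bounded by that of one exact protocol.
  have hmax : ∀ ℓ, ∃ i ∈ S, ∀ j ∈ S, C j ℓ ≤ C i ℓ := by
    intro ℓ
    obtain ⟨P, hP⟩ := Protocol.exists_run_eq (xorPow f ℓ)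
    have hle : ∀ i, C i ℓ ≤ P.cost := fun i => distComplexity_le_cost <| by
      have : ρ ^ ℓ ≤ 1 := pow_le_one₀ hρ0 hρ1
      have h0 : P.errorProb (xorPow f ℓ) (prodPow (D i) ℓ) = 0 := by simp [Protocol.errorProb, hP]
      rw [h0]
      linarith
    have hbdd : BddAbove ((C · ℓ) '' S) := ⟨P.cost, by rintro _ ⟨i, _, rfl⟩; exact hle i⟩
    obtain ⟨i, hi, hi'⟩ := Nat.sSup_mem (hS.image (C · ℓ)) hbdd
    exact ⟨i, hi, fun j hj => (le_csSup hbdd ⟨j, hj, rfl⟩).trans_eq hi'.symm⟩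
  choose i hi hmax using hmax
  -- The maximiser for `a + b` blocks competes in the maxima for `a` and for `b`.
  have hsub : Subadditive fun ℓ => (C (i ℓ) ℓ : ℝ) := fun a b => by
    refine le_trans ?_ (add_le_add (Nat.cast_le.2 (hmax a _ (hi (a + b))))
      (Nat.cast_le.2 (hmax b _ (hi (a + b)))))
    have hadd : C (i (a + b)) (a + b) ≤ C (i (a + b)) a + C (i (a + b)) b :=
      distComplexity_add_le hρ0 hρ1 f (hD _ (hi (a + b))) a b
    beta_reduce
    exact_mod_cast hadd
  have hbdd : BddBelow (Set.range fun ℓ : ℕ => (C (i ℓ) ℓ : ℝ) / ℓ) :=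
    ⟨0, by rintro _ ⟨ℓ, rfl⟩; positivity⟩
  refine ⟨fun ℓ => 1 / (ℓ : ℝ) * C (i ℓ) ℓ, hsub.lim, fun ℓ => ⟨⟨i ℓ, hi ℓ, rfl⟩, ?_⟩, ?_⟩
  · rintro _ ⟨j, hj, rfl⟩
    exact mul_le_mul_of_nonneg_left (Nat.cast_le.2 (hmax ℓ j hj)) (by positivity)
  · simpa only [one_div, ← div_eq_inv_mul] using hsub.tendsto_lim hbdd

theorem exists_tendsto_of_eventually_le_succ {L : ℕ → EReal}
    (h : ∀ᶠ n in atTop, L n ≤ L (n + 1)) : ∃ A, Tendsto L atTop (𝓝 A) := by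
  obtain ⟨m, hm⟩ := eventually_atTop.1 h
  have hmono : Monotone fun n => L (n + m) := monotone_nat_of_le_succ fun n => by
    have := hm (n + m) (by omega)
    rwa [add_right_comm] at this
  exact ⟨_, (tendsto_add_atTop_iff_nat m).1 (tendsto_atTop_iSup hmono)⟩

theorem exists_iterated_limit_max_distComplexity {ι X : ℕ → Type} [∀ n, Fintype (X n)] {ρ : ℝ}
    (hρ0 : 0 ≤ ρ) (hρ1 : ρ ≤ 1) (f : ∀ n, X n → X n → ZMod 2) {S : ∀ n, Set (ι n)}
    (hS : ∀ n, (S n).Nonempty) {D : ∀ n, ι n → X n × X n → ℝ}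
    (hD : ∀ n, ∀ i ∈ S n, D n i ∈ stdSimplex ℝ (X n × X n))
    (hmono : ∀ᶠ n in atTop, ∀ i ∈ S n, ∃ j ∈ S (n + 1), ∀ ℓ,
      distComplexity (ρ ^ ℓ) (xorPow (f n) ℓ) (prodPow (D n i) ℓ) ≤
        distComplexity (ρ ^ ℓ) (xorPow (f (n + 1)) ℓ) (prodPow (D (n + 1) j) ℓ))
    {b : ℕ → ℝ} {B : ℝ} (hb : Tendsto b atTop (𝓝 B))
    (hlow : ∀ᶠ n in atTop, ∃ i ∈ S n, ∀ ℓ : ℕ, ℓ ≠ 0 →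
      b n ≤ 1 / (ℓ : ℝ) * (distComplexity (ρ ^ ℓ) (xorPow (f n) ℓ) (prodPow (D n i) ℓ) : ℝ)) :
    ∃ (M : ℕ → ℕ → ℝ) (L : ℕ → ℝ) (A : EReal),
      (∀ n ℓ : ℕ, IsGreatest {c : ℝ | ∃ i ∈ S n, c = 1 / (ℓ : ℝ) *
        (distComplexity (ρ ^ ℓ) (xorPow (f n) ℓ) (prodPow (D n i) ℓ) : ℝ)} (M n ℓ)) ∧
      (∀ n : ℕ, Tendsto (fun ℓ : ℕ => M n ℓ) atTop (𝓝 (L n))) ∧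
      Tendsto (fun n : ℕ => (L n : EReal)) atTop (𝓝 A) ∧ (B : EReal) ≤ A := by
  choose M L hM hL using fun n =>
    exists_limit_max_distComplexity hρ0 hρ1 (f n) (hS n) (hD n)
  have hLmono : ∀ᶠ n in atTop, (L n : EReal) ≤ L (n + 1) := hmono.mono fun n hn => by
    refine EReal.coe_le_coe_iff.2 (le_of_tendsto_of_tendsto' (hL n) (hL (n + 1)) fun ℓ => ?_)
    obtain ⟨i, hi, hiM⟩ := (hM n ℓ).1
    obtain ⟨j, hj, hij⟩ := hn i hi
    rw [hiM]
    refine le_trans ?_ ((hM (n + 1) ℓ).2 ⟨j, hj, rfl⟩)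
    exact mul_le_mul_of_nonneg_left (Nat.cast_le.2 (hij ℓ)) (by positivity)
  obtain ⟨A, hA⟩ := exists_tendsto_of_eventually_le_succ hLmono
  refine ⟨M, L, A, hM, hL, hA, ?_⟩
  refine le_of_tendsto_of_tendsto ((continuous_coe_real_ereal.tendsto B).comp hb) hA ?_
  refine hlow.mono fun n ⟨i, hi, hn⟩ => EReal.coe_le_coe_iff.2 ?_
  refine ge_of_tendsto (hL n) ?_
  filter_upwards [eventually_ne_atTop 0] with ℓ hℓ
  exact (hn ℓ hℓ).trans ((hM n ℓ).2 ⟨i, hi, rfl⟩)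

end Limits

/-! ### Symmetric noise, and redistribution of agreement between positions. -/

section SymmetricNoise

theorem ZMod.sum_two {α : Type*} [AddCommMonoid α] (g : ZMod 2 → α) : ∑ z, g z = g 0 + g 1 :=
  Fin.sum_univ_two g

/-- The probability of the value `e` for a bit that vanishes with probability `q`. -/
def bitNoise (q : ℝ) (e : ZMod 2) : ℝ := if e = 0 then q else 1 - q

@[simp] theorem bitNoise_zero (q : ℝ) : bitNoise q 0 = q := by simp [bitNoise]

@[simp] theorem bitNoise_one (q : ℝ) : bitNoise q 1 = 1 - q := by simp [bitNoise]

theorem bitNoise_nonneg {q : ℝ} (h0 : 0 ≤ q) (h1 : q ≤ 1) (e : ZMod 2) : 0 ≤ bitNoise q e := by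
  unfold bitNoise
  split_ifs <;> linarith

/-- The law of a pair of bits with uniform marginals that agree with probability `q`. -/
noncomputable def noisyPair (q : ℝ) (p : ZMod 2 × ZMod 2) : ℝ := bitNoise q (p.1 - p.2) / 2

theorem noisyPair_mem_stdSimplex {q : ℝ} (h0 : 0 ≤ q) (h1 : q ≤ 1) :
    noisyPair q ∈ stdSimplex ℝ (ZMod 2 × ZMod 2) := by
  refine ⟨fun p => div_nonneg (bitNoise_nonneg h0 h1 _) zero_le_two, ?_⟩
  have h : (0 - 1 : ZMod 2) = 1 := by decide
  simp only [Fintype.sum_prod_type, ZMod.sum_two, noisyPair, h, sub_self, sub_zero, bitNoise_zero,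
    bitNoise_one]
  ring

/-- The law of a pair of strings with independent positions and uniform marginals whose `i`-th
positions agree with probability `q i`. -/
noncomputable def noisyStrings {n : ℕ} (q : Fin n → ℝ)
    (p : (Fin n → ZMod 2) × (Fin n → ZMod 2)) : ℝ :=
  ∏ i, noisyPair (q i) (p.1 i, p.2 i)

theorem prodPow_noisyPair (q : ℝ) (n : ℕ) : prodPow (noisyPair q) n = noisyStrings fun _ => q :=
  rfl

theorem half_mem_stdSimplex : (fun _ : ZMod 2 => (1 / 2 : ℝ)) ∈ stdSimplex ℝ (ZMod 2) :=
  ⟨fun _ => by norm_num, by rw [ZMod.sum_two]; norm_num⟩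

theorem isRandomImage_noisyPair {ν : ZMod 2 × ZMod 2 → ℝ}
    (hν : ν ∈ stdSimplex ℝ (ZMod 2 × ZMod 2)) :
    IsRandomImage (fun _ : ZMod 2 => (1 / 2 : ℝ)) (fun z x => x + z) (fun z y => y + z) ν
      (noisyPair (ν (0, 0) + ν (1, 1))) := by
  intro g
  have hsum := hν.2
  have h1 : (0 - 1 : ZMod 2) = 1 := by decide
  have h2 : (1 + 1 : ZMod 2) = 0 := by decide
  simp only [Fintype.sum_prod_type, ZMod.sum_two, noisyPair, h1, h2, sub_self, sub_zero,
    bitNoise_zero, bitNoise_one, add_zero, zero_add] at hsum ⊢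
  linear_combination (-(g (0, 1) + g (1, 0)) / 2) * hsum

theorem isRandomImage_of_involutive {X ι : Type} [Fintype X] [Fintype ι] {w : ι → ℝ}
    {φ : ι → X → X} (hφ : ∀ r, Function.Involutive (φ r)) {μ μ' : X × X → ℝ}
    (h : ∀ z, μ' z = ∑ r, w r * μ (φ r z.1, φ r z.2)) : IsRandomImage w φ φ μ μ' := by
  intro g
  simp_rw [h, Finset.sum_mul]
  rw [Finset.sum_comm]
  refine Finset.sum_congr rfl fun r _ => ?_
  simp_rw [mul_assoc]
  rw [← Finset.mul_sum]
  congr 1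
  refine Fintype.sum_equiv (Equiv.prodCongr (hφ r).toPerm (hφ r).toPerm) _ _ fun z => ?_
  simp [Prod.map, hφ r z.1, hφ r z.2]

/-- The differences `(e, e')` of two positions are kept, swapped with weight `s`, or sheared to `(e,
e' + e)` with weight `t`. All three maps fix `(0, 0)`, whence the constraint `a' r' = a r`; the
masses at `(0, 1)` and `(1, 1)` then determine `s` and `t`. -/
theorem exists_transfer_weights {a r a' r' : ℝ} (ha : 1 / 2 ≤ a) (hr : r ≤ 1)
    (haa' : a ≤ a') (har : a' ≤ r) (hmul : a' * r' = a * r) :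
    ∃ s t : ℝ, 0 ≤ s ∧ 0 ≤ t ∧ s + t ≤ 1 ∧ ∀ e e' : ZMod 2,
      bitNoise a' e * bitNoise r' e' =
        (1 - s - t) * (bitNoise a e * bitNoise r e') + s * (bitNoise a e' * bitNoise r e) +
          t * (bitNoise a e * bitNoise r (e' + e)) := by
  have ha' : 0 < a' := by linarith
  have h2 : (1 + 1 : ZMod 2) = 0 := by decide
  suffices H : ∃ s t : ℝ, 0 ≤ s ∧ 0 ≤ t ∧ s + t ≤ 1 ∧ s * (r - a) = a' - a ∧
      t * ((1 - a) * (2 * r - 1)) = a + r - a' - r' by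
    obtain ⟨s, t, hs, ht, hst, hs', ht'⟩ := H
    refine ⟨s, t, hs, ht, hst, fun e e' => ?_⟩
    rcases ZMod.eq_zero_or_eq_one e with rfl | rfl <;>
      rcases ZMod.eq_zero_or_eq_one e' with rfl | rfl <;>
      simp only [h2, add_zero, zero_add, bitNoise_zero, bitNoise_one]
    · linear_combination hmul
    · linear_combination -hmul - hs'
    · linear_combination -hmul + hs' + ht'
    · linear_combination hmul - ht'
  rcases (haa'.trans har).eq_or_lt with rfl | hlt
  · obtain rfl : a = a' := le_antisymm haa' har
    obtain rfl : r' = a := mul_left_cancel₀ ha'.ne' hmul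
    exact ⟨0, 0, by simp⟩
  · have h1 : 0 < r - a := by linarith
    have h3 : 0 < 1 - a := by linarith
    have h4 : 0 < 2 * r - 1 := by linarith
    have hr' : r' = a * r / a' := by field_simp; linarith
    refine ⟨(a' - a) / (r - a), (a' - a) * (r - a') / (a' * ((1 - a) * (2 * r - 1))),
      div_nonneg (by linarith) h1.le,
      div_nonneg (mul_nonneg (by linarith) (by linarith)) (by positivity), ?_, ?_, ?_⟩
    -- This yields `t ≤ (r - a') / (r - a) = 1 - s`.
    · have key : (a' - a) * (r - a) ≤ a' * ((1 - a) * (2 * r - 1)) := by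
        have e1 : a' - a ≤ a' * (1 - a) := by nlinarith
        have e2 : r - a ≤ 2 * r - 1 := by linarith
        calc _ ≤ (a' * (1 - a)) * (2 * r - 1) := mul_le_mul e1 e2 h1.le (by positivity)
          _ = _ := by ring
      have hle : (a' - a) * (r - a') / (a' * ((1 - a) * (2 * r - 1))) ≤ (r - a') / (r - a) := by
        rw [div_le_div_iff₀ (by positivity) h1]
        calc _ = (r - a') * ((a' - a) * (r - a)) := by ring
          _ ≤ _ := mul_le_mul_of_nonneg_left key (by linarith)
      calc _ ≤ (a' - a) / (r - a) + (r - a') / (r - a) := by gcongr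
        _ = 1 := by rw [← add_div, sub_add_sub_cancel', div_self h1.ne']
    · field_simp
    · have hK : 0 < (1 - a) * (2 * r - 1) := by positivity
      generalize (1 - a) * (2 * r - 1) = K at hK ⊢
      rw [hr']
      field_simp
      ring

theorem prod_eq_mul_mul_prod_erase {n : ℕ} {i j : Fin n} (hij : i ≠ j) (F : Fin n → ℝ) :
    ∏ k, F k = F i * F j * ∏ k ∈ (Finset.univ.erase i).erase j, F k := by
  rw [mul_assoc, Finset.mul_prod_erase _ _ (Finset.mem_erase.2 ⟨hij.symm, Finset.mem_univ _⟩),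
    Finset.mul_prod_erase _ _ (Finset.mem_univ _)]

/-- Moving the agreement probabilities of two positions towards each other, with a fixed product,
does not make equality easier. -/
theorem distComplexity_eqFun_le_of_transfer {n : ℕ} {q q' : Fin n → ℝ} {i j : Fin n} (hij : i ≠ j)
    (hi : 1 / 2 ≤ q i) (hj : q j ≤ 1) (hii' : q i ≤ q' i) (hij' : q' i ≤ q j)
    (hmul : q' i * q' j = q i * q j) (hrest : ∀ k, k ≠ i → k ≠ j → q' k = q k) {σ : ℝ}
    (hσ : σ ≤ 1) (ℓ : ℕ) :
    distComplexity σ (xorPow (eqFun n) ℓ) (prodPow (noisyStrings q) ℓ) ≤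
      distComplexity σ (xorPow (eqFun n) ℓ) (prodPow (noisyStrings q') ℓ) := by
  obtain ⟨s, t, hs, ht, hst, key⟩ := exists_transfer_weights hi hj hii' hij' hmul
  let φ : Fin 3 → (Fin n → ZMod 2) → Fin n → ZMod 2 :=
    ![id, fun x => x ∘ Equiv.swap i j, fun x => Function.update x j (x j + x i)]
  have h2 : ∀ z w : ZMod 2, z + w + w = z := by decide
  have hφ : ∀ r, Function.Involutive (φ r) := by
    intro r
    fin_cases r
    · exact fun x => rfl
    · intro x
      funext k
      simp [φ]
    · intro x
      simp [φ, hij, h2]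
  have hw : ![1 - s - t, s, t] ∈ stdSimplex ℝ (Fin 3) := by
    refine ⟨fun r => ?_, by simp [Fin.sum_univ_succ]⟩
    fin_cases r
    · simpa using by linarith
    · exact hs
    · exact ht
  have himage : IsRandomImage ![1 - s - t, s, t] φ φ (noisyStrings q) (noisyStrings q') := by
    refine isRandomImage_of_involutive hφ fun z => ?_
    obtain ⟨x, y⟩ := z
    have hR : ∀ (u v : Fin n → ZMod 2) (p : Fin n → ℝ), (∀ k, k ≠ i → k ≠ j → u k = x k) →
        (∀ k, k ≠ i → k ≠ j → v k = y k) → (∀ k, k ≠ i → k ≠ j → p k = q k) →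
        noisyStrings p (u, v) = noisyPair (p i) (u i, v i) * noisyPair (p j) (u j, v j) *
          ∏ k ∈ (Finset.univ.erase i).erase j, noisyPair (q k) (x k, y k) := by
      intro u v p hu hv hp
      rw [noisyStrings, prod_eq_mul_mul_prod_erase hij]
      congr 1
      refine Finset.prod_congr rfl fun k hk => ?_
      obtain ⟨hkj, hk⟩ := Finset.mem_erase.1 hk
      have hki := (Finset.mem_erase.1 hk).1
      simp only [hu k hki hkj, hv k hki hkj, hp k hki hkj]
    have hswap : ∀ (x : Fin n → ZMod 2) (k), k ≠ i → k ≠ j → φ 1 x k = x k := by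
      intro x k hki hkj
      simp [φ, Equiv.swap_apply_of_ne_of_ne hki hkj]
    have hadd : ∀ (x : Fin n → ZMod 2) (k), k ≠ i → k ≠ j → φ 2 x k = x k := by
      intro x k hki hkj
      simp [φ, hkj]
    rw [hR x y q' (fun _ _ _ => rfl) (fun _ _ _ => rfl) hrest, Fin.sum_univ_three,
      hR (φ 0 x) (φ 0 y) q (fun _ _ _ => rfl) (fun _ _ _ => rfl) (fun _ _ _ => rfl),
      hR (φ 1 x) (φ 1 y) q (hswap x) (hswap y) (fun _ _ _ => rfl),
      hR (φ 2 x) (φ 2 y) q (hadd x) (hadd y) (fun _ _ _ => rfl)]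
    have hk := key (x i - y i) (x j - y j)
    simp only [φ, Matrix.cons_val_zero, Matrix.cons_val_one, Matrix.cons_val, id, noisyPair,
      Function.comp_apply, Equiv.swap_apply_left, Equiv.swap_apply_right,
      Function.update_self, Function.update_of_ne hij, add_sub_add_comm]
    linear_combination (1 / 4 *
      ∏ k ∈ (Finset.univ.erase i).erase j, bitNoise (q k) (x k - y k) / 2) * hk
  refine himage.distComplexity_xorPow_le hw hσ (fun r x y => ?_) ℓ
  simp only [eqFun, (hφ r).injective.eq_iff]

theorem isRandomImage_cons {n : ℕ} (q : Fin n → ℝ) :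
    IsRandomImage (fun _ : ZMod 2 => (1 / 2 : ℝ)) (fun z (x : Fin n → ZMod 2) => Fin.cons z x)
      (fun z (y : Fin n → ZMod 2) => (Fin.cons z y : Fin (n + 1) → ZMod 2)) (noisyStrings q)
      (noisyStrings (Fin.cons 1 q : Fin (n + 1) → ℝ)) := by
  intro g
  have h1 : (0 - 1 : ZMod 2) = 1 := by decide
  simp only [Fintype.sum_prod_type, sum_pi_succ, noisyStrings, Fin.prod_univ_succ, Fin.cons_zero,
    Fin.cons_succ, ZMod.sum_two]
  simp only [noisyPair, h1, sub_self, sub_zero, bitNoise_zero, bitNoise_one, zero_div, zero_mul,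
    Finset.sum_const_zero, add_zero, zero_add, Finset.mul_sum, mul_assoc]

/-- With a fixed, not too small probability of agreement, longer strings do not make equality
easier. -/
theorem exists_noisyPair_distComplexity_le {q : ℝ} (h0 : 1 / 2 ≤ q) (h1 : q ≤ 1) (n : ℕ) :
    ∃ ν ∈ stdSimplex ℝ (ZMod 2 × ZMod 2), ∀ σ ≤ (1 : ℝ), ∀ ℓ : ℕ,
      distComplexity σ (xorPow (eqFun n) ℓ) (prodPow (prodPow (noisyPair q) n) ℓ) ≤
        distComplexity σ (xorPow (eqFun (n + 1)) ℓ) (prodPow (prodPow ν (n + 1)) ℓ) := by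
  have hq0 : 0 < q := by linarith
  -- The probability that the whole strings agree must be preserved.
  obtain ⟨q', hq'0, hpow⟩ : ∃ q' : ℝ, 0 < q' ∧ q' ^ (n + 1) = q ^ n :=
    ⟨(q ^ n) ^ (((n + 1 : ℕ) : ℝ)⁻¹), by positivity,
      Real.rpow_inv_natCast_pow (by positivity) (Nat.succ_ne_zero n)⟩
  have hq'1 : q' ≤ 1 := by
    by_contra! h
    exact absurd (hpow.trans_le (pow_le_one₀ hq0.le h1)) (not_le.2 (one_lt_pow₀ h n.succ_ne_zero))
  have hqq' : q ≤ q' := by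
    refine le_of_pow_le_pow_left₀ n.succ_ne_zero hq'0.le ?_
    rw [hpow, pow_succ]
    exact mul_le_of_le_one_right (by positivity) h1
  have hratio : (q / q') ^ n = q' := by
    rw [div_pow, ← hpow, pow_succ]
    field_simp
  have hratio1 : q / q' ≤ 1 := (div_le_one hq'0).2 hqq'
  have hratio0 : 0 ≤ q / q' := by positivity
  refine ⟨noisyPair q', noisyPair_mem_stdSimplex hq'0.le hq'1, fun σ hσ ℓ => ?_⟩
  -- After `m` transfers, `m` of the old positions have risen to `q'` at the expense of position
  -- `0`, the product staying `q ^ n`. At `m = n` position `0` has itself come down to `q'`.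
  let κ : ℕ → Fin (n + 1) → ℝ := fun m =>
    Fin.cons ((q / q') ^ m) fun k => if (k : ℕ) < m then q' else q
  have hstep : ∀ m ≤ n,
      distComplexity σ (xorPow (eqFun n) ℓ) (prodPow (noisyStrings fun _ => q) ℓ) ≤
        distComplexity σ (xorPow (eqFun (n + 1)) ℓ) (prodPow (noisyStrings (κ m)) ℓ) := by
    intro m
    induction m with
    | zero =>
      intro _
      have hκ : κ 0 = Fin.cons 1 fun _ => q := by simp [κ]
      rw [hκ]
      exact (isRandomImage_cons _).distComplexity_xorPow_le half_mem_stdSimplex hσ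
        (fun r x y => by simp [eqFun, Fin.cons_inj]) ℓ
    | succ m ih =>
      intro hm
      refine (ih (by omega)).trans ?_
      obtain ⟨i, rfl⟩ : ∃ i : Fin n, (i : ℕ) = m := ⟨⟨m, hm⟩, rfl⟩
      refine distComplexity_eqFun_le_of_transfer (i := i.succ) (j := 0)
        (Fin.succ_ne_zero _) ?_ ?_ ?_ ?_ ?_ (fun k hki hk0 => ?_) hσ ℓ
      · simpa [κ] using h0
      · simpa [κ] using pow_le_one₀ hratio0 hratio1
      · simpa [κ] using hqq'
      · have := pow_le_pow_of_le_one hratio0 hratio1 (show (i : ℕ) ≤ n by omega)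
        rw [hratio] at this
        simpa [κ] using this
      · simp only [κ, Fin.cons_succ, Fin.cons_zero, lt_add_iff_pos_right, zero_lt_one, if_true,
          lt_irrefl, if_false, pow_succ]
        field_simp
      · obtain ⟨k, rfl⟩ := Fin.exists_succ_eq.2 hk0
        have hne : (k : ℕ) ≠ i := fun h => hki (by rw [Fin.succ_inj]; exact Fin.ext h)
        have hiff : (k : ℕ) < i + 1 ↔ (k : ℕ) < i := by omega
        simp [κ, hiff]
  have hκ : κ n = fun _ => q' := by
    funext k
    refine Fin.cases ?_ (fun k => ?_) k
    · simpa [κ] using hratio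
    · simp [κ]
  simpa only [hκ, prodPow_noisyPair] using hstep n le_rfl

end SymmetricNoise

/-! ### Monotonicity in the string length. -/

section EqualityMonotone

theorem distComplexity_one_le_of_pos {X Y : Type} [Fintype X] [Fintype Y] (f : X → Y → ZMod 2)
    (μ : X × Y → ℝ) {μ' : X × Y → ℝ} (hμ' : ∀ p, 0 < μ' p) :
    distComplexity 1 f μ ≤ distComplexity 1 f μ' := by
  obtain ⟨P, hP, hPe⟩ := exists_protocol_cost_eq_distComplexity le_rfl f μ'
  rw [sub_self, zero_div] at hPe
  have hrun : ∀ p : X × Y, P.run p.1 p.2 = f p.1 p.2 := by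
    by_contra! h
    obtain ⟨p, hp⟩ := h
    refine absurd hPe (not_le.2 (Finset.sum_pos' (fun z _ => ?_) ⟨p, Finset.mem_univ p, ?_⟩))
    · split_ifs
      exacts [(hμ' z).le, le_rfl]
    · simpa [hp] using hμ' p
  rw [← hP]
  refine distComplexity_le_cost ?_
  have h0 : P.errorProb f μ = 0 := by simp [Protocol.errorProb, hrun]
  simp [h0]

theorem sum_bitSign_eqFun_mul {n : ℕ} (μ : (Fin n → ZMod 2) × (Fin n → ZMod 2) → ℝ) :
    ∑ p, bitSign (eqFun n p.1 p.2) * μ p = ∑ p, μ p - 2 * ∑ x, μ (x, x) := by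
  have h (x y : Fin n → ZMod 2) :
      bitSign (eqFun n x y) * μ (x, y) = μ (x, y) - if x = y then 2 * μ (x, y) else 0 := by
    unfold eqFun
    split_ifs <;> simp
    ring
  simp [Fintype.sum_prod_type, h, Finset.sum_sub_distrib, Finset.mul_sum]

/-- The constant output `0` has correlation `1 - 2 Pr[x = y]` with equality on each block, and these
multiply. -/
theorem distComplexity_eqFun_eq_zero {n : ℕ} {ν : ZMod 2 × ZMod 2 → ℝ}
    (hν : ν ∈ stdSimplex ℝ (ZMod 2 × ZMod 2)) {ρ : ℝ} (hρ0 : 0 ≤ ρ)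
    (hρ : ρ ≤ 1 - 2 * (ν (0, 0) + ν (1, 1)) ^ n) (ℓ : ℕ) :
    distComplexity (ρ ^ ℓ) (xorPow (eqFun n) ℓ) (prodPow (prodPow ν n) ℓ) = 0 := by
  have hn := prodPow_mem_stdSimplex hν n
  refine Nat.le_zero.1 (distComplexity_le_cost (P := Protocol.output 0) ?_)
  rw [Protocol.errorProb_le_iff _ _ (prodPow_mem_stdSimplex hn ℓ).2]
  have hdiag : ∑ x : Fin n → ZMod 2, prodPow ν n (x, x) = (ν (0, 0) + ν (1, 1)) ^ n := by
    rw [← ZMod.sum_two fun z => ν (z, z), Fintype.sum_pow]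
    rfl
  have hcorr : (Protocol.output 0).correlation (xorPow (eqFun n) ℓ) (prodPow (prodPow ν n) ℓ) =
      (1 - 2 * (ν (0, 0) + ν (1, 1)) ^ n) ^ ℓ := by
    rw [← hdiag, ← hn.2, ← sum_bitSign_eqFun_mul, ← sum_prod_pair]
    refine Finset.sum_congr rfl fun p _ => ?_
    rw [xorPow, bitSign_sum, prodPow, Finset.prod_mul_distrib, Protocol.run, bitSign_zero, one_mul]
  rw [hcorr]
  exact pow_le_pow_left₀ hρ0 hρ ℓ

/-- The transfer argument needs agreement probability at least `1/2`. Below that, either a constant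
output already suffices, or `ρ = 1` and no law is harder than one of full support. -/
theorem exists_prodPow_distComplexity_le {ρ : ℝ} (hρ0 : 0 ≤ ρ) (hρ1 : ρ ≤ 1) {n : ℕ}
    (hn : ρ = 1 ∨ ρ ≤ 1 - 2 * (1 / 2) ^ n) {ν : ZMod 2 × ZMod 2 → ℝ}
    (hν : ν ∈ stdSimplex ℝ (ZMod 2 × ZMod 2)) :
    ∃ ν' ∈ stdSimplex ℝ (ZMod 2 × ZMod 2), ∀ ℓ : ℕ,
      distComplexity (ρ ^ ℓ) (xorPow (eqFun n) ℓ) (prodPow (prodPow ν n) ℓ) ≤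
        distComplexity (ρ ^ ℓ) (xorPow (eqFun (n + 1)) ℓ) (prodPow (prodPow ν' (n + 1)) ℓ) := by
  have hpow (ℓ : ℕ) : ρ ^ ℓ ≤ 1 := pow_le_one₀ hρ0 hρ1
  have hq0 : 0 ≤ ν (0, 0) + ν (1, 1) := add_nonneg (hν.1 _) (hν.1 _)
  rcases le_or_gt (1 / 2) (ν (0, 0) + ν (1, 1)) with hq | hq
  · have hq1 : ν (0, 0) + ν (1, 1) ≤ 1 := by
      have := hν.2
      simp only [Fintype.sum_prod_type, ZMod.sum_two] at this
      linarith [hν.1 (0, 1), hν.1 (1, 0)]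
    obtain ⟨ν', hν', h⟩ := exists_noisyPair_distComplexity_le hq hq1 n
    refine ⟨ν', hν', fun ℓ => le_trans ?_ (h _ (hpow ℓ) ℓ)⟩
    exact ((isRandomImage_noisyPair hν).prodPow n).distComplexity_xorPow_le
      (prod_mem_stdSimplex half_mem_stdSimplex n) (hpow ℓ)
      (fun r x y => by simp [eqFun, funext_iff]) ℓ
  rcases hn with rfl | hn
  · obtain ⟨ν', hν', h⟩ := exists_noisyPair_distComplexity_le le_rfl
      (by norm_num : (1 / 2 : ℝ) ≤ 1) n
    refine ⟨ν', hν', fun ℓ => le_trans ?_ (h _ (hpow ℓ) ℓ)⟩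
    rw [one_pow]
    refine distComplexity_one_le_of_pos _ _ fun p => Finset.prod_pos fun i _ =>
      Finset.prod_pos fun j _ => ?_
    unfold noisyPair bitNoise
    split_ifs <;> norm_num
  · refine ⟨ν, hν, fun ℓ => ?_⟩
    rw [distComplexity_eqFun_eq_zero hν hρ0 (hn.trans ?_) ℓ]
    · exact Nat.zero_le _
    · have := pow_le_pow_left₀ hq0 hq.le n
      linarith

theorem exists_distComplexity_eqFun_succ_le {n : ℕ}
    {μ : (Fin n → ZMod 2) × (Fin n → ZMod 2) → ℝ} (hμ : μ ∈ stdSimplex ℝ _) :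
    ∃ μ' ∈ stdSimplex ℝ ((Fin (n + 1) → ZMod 2) × (Fin (n + 1) → ZMod 2)),
      ∀ σ ≤ (1 : ℝ), ∀ ℓ : ℕ, distComplexity σ (xorPow (eqFun n) ℓ) (prodPow μ ℓ) ≤
        distComplexity σ (xorPow (eqFun (n + 1)) ℓ) (prodPow μ' ℓ) := by
  classical
  have hw : (fun _ : Unit => (1 : ℝ)) ∈ stdSimplex ℝ Unit := ⟨fun _ => zero_le_one, by simp⟩
  let φ : Unit → (Fin n → ZMod 2) → Fin (n + 1) → ZMod 2 := fun _ x => Fin.cons 0 x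
  let μ' : (Fin (n + 1) → ZMod 2) × (Fin (n + 1) → ZMod 2) → ℝ := fun z =>
    ∑ p, if (φ () p.1, φ () p.2) = z then μ p else 0
  have himage : IsRandomImage (fun _ => 1) φ φ μ μ' := isRandomImage_iff.2 fun z => by simp [μ']
  refine ⟨μ', ⟨fun z => Finset.sum_nonneg fun p _ => ?_, (himage.sum_eq hw).trans hμ.2⟩,
    fun σ hσ ℓ => himage.distComplexity_xorPow_le hw hσ (fun r x y => ?_) ℓ⟩
  · split_ifs
    exacts [hμ.1 p, le_rfl]
  · simp [φ, eqFun, Fin.cons_inj]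

end EqualityMonotone

/-! ### Operator norms for the two input laws. -/

section SpectralBounds

/-- With `J` the all-ones matrix, the signed matrix is `αJ - βI`, with eigenvalues `Nα - β` on
constants and `-β` on their complement; `Nα ≤ 2β` makes `β` the norm. -/
theorem exists_hasOpBound_eqFun {n : ℕ} (hn : n ≠ 0) :
    ∃ μ ∈ stdSimplex ℝ ((Fin n → ZMod 2) × (Fin n → ZMod 2)),
      HasOpBound (fun x y => bitSign (eqFun n x y) * μ (x, y))
        ((1 / 3 + 2 / 3 / ((2 : ℝ) ^ n - 1)) / Fintype.card (Fin n → ZMod 2)) := by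
  set N : ℝ := 2 ^ n with hN
  have hcard : (Fintype.card (Fin n → ZMod 2) : ℝ) = N := by simp [hN]
  have hN1 : 1 < N := one_lt_pow₀ (by norm_num) hn
  have hN0 : 0 < N := by linarith
  have hN2 : 0 < N - 1 := by linarith
  set α : ℝ := 2 / 3 / (N * (N - 1)) with hα
  set β : ℝ := α + 1 / 3 / N with hβ
  have hα0 : 0 < α := by positivity
  have hβc : (1 / 3 + 2 / 3 / (N - 1)) / N = β := by
    rw [hβ, hα]
    field_simp
    ring
  have hαβ : N * α ≤ 2 * β := by
    have h1 : 2 * β - N * α = 2 / 3 / (N * (N - 1)) := by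
      rw [hβ, hα]
      field_simp
      ring
    have h2 : 0 ≤ 2 / 3 / (N * (N - 1)) := by positivity
    linarith
  refine ⟨fun p => if p.1 = p.2 then 1 / 3 / N else α, ⟨fun p => ?_, ?_⟩, ?_⟩
  · dsimp only
    split_ifs <;> positivity
  · have h (x y : Fin n → ZMod 2) : (if x = y then 1 / 3 / N else α) =
        α + if x = y then 1 / 3 / N - α else 0 := by
      split_ifs <;> ring
    simp only [Fintype.sum_prod_type, h, Finset.sum_add_distrib, Finset.sum_ite_eq,
      Finset.mem_univ, if_true, Finset.sum_const, Finset.card_univ, nsmul_eq_mul, hcard,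
      Fintype.card_prod, Nat.cast_mul]
    rw [hα]
    field_simp
    ring
  · rw [hcard, hβc]
    intro v
    have h (x : Fin n → ZMod 2) : ∑ y, bitSign (eqFun n x y) *
        (if x = y then 1 / 3 / N else α) * v y = α * ∑ y, v y - β * v x := by
      have h' (y) : bitSign (eqFun n x y) * (if x = y then 1 / 3 / N else α) * v y =
          α * v y - if x = y then β * v y else 0 := by
        unfold eqFun
        split_ifs <;> simp [hβ]
        ring
      simp only [h', Finset.sum_sub_distrib, ← Finset.mul_sum, Finset.sum_ite_eq,
        Finset.mem_univ, if_true]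
    simp only [h]
    set S := ∑ y, v y with hS
    have hexp : ∑ x, (α * S - β * v x) ^ 2 =
        N * (α * S) ^ 2 - 2 * β * α * S * S + β ^ 2 * ∑ x, v x ^ 2 := by
      have e (x) : (α * S - β * v x) ^ 2 =
          (α * S) ^ 2 - 2 * β * α * S * v x + β ^ 2 * v x ^ 2 := by ring
      simp only [e, Finset.sum_add_distrib, Finset.sum_sub_distrib, ← Finset.mul_sum,
        Finset.sum_const, Finset.card_univ, nsmul_eq_mul, hcard, ← hS]
    rw [hexp]
    nlinarith [mul_nonneg (mul_nonneg hα0.le (sq_nonneg S)) (sub_nonneg.2 hαβ)]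

/-- The noise operator on `n` bits has all its eigenvalues in `[θ ^ n, 1]`, where `θ = 2 q - 1`. -/
theorem sum_noise_sub_sq_le {q : ℝ} (hq0 : 1 / 2 ≤ q) (hq1 : q ≤ 1) {c b : ℝ} (n : ℕ) {a : ℝ}
    (ha : 0 ≤ a) (h1 : |a - c| ≤ b) (h2 : |a * (2 * q - 1) ^ n - c| ≤ b)
    (v : (Fin n → ZMod 2) → ℝ) :
    ∑ x, (a * ∑ y, (∏ i, bitNoise q (x i - y i)) * v y - c * v x) ^ 2 ≤ b ^ 2 * ∑ x, v x ^ 2 := by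
  have hθ0 : 0 ≤ 2 * q - 1 := by linarith
  have hθ1 : 2 * q - 1 ≤ 1 := by linarith
  induction n generalizing a with
  | zero =>
    have h : (a - c) ^ 2 ≤ b ^ 2 := sq_le_sq' (abs_le.1 h1).1 (abs_le.1 h1).2
    simp only [Fintype.sum_unique, Finset.univ_eq_empty, Finset.prod_empty, one_mul]
    rw [← sub_mul, mul_pow]
    gcongr
  | succ n ih =>
    set G : ((Fin n → ZMod 2) → ℝ) → (Fin n → ZMod 2) → ℝ := fun u x =>
      ∑ y, (∏ i, bitNoise q (x i - y i)) * u y with hG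
    set v₀ : (Fin n → ZMod 2) → ℝ := fun x => v (Fin.cons 0 x) with hv₀
    set v₁ : (Fin n → ZMod 2) → ℝ := fun x => v (Fin.cons 1 x) with hv₁
    have hadd (x) : G (fun x => v₀ x + v₁ x) x = G v₀ x + G v₁ x := by
      simp only [hG, mul_add, Finset.sum_add_distrib]
    have hsub (x) : G (fun x => v₀ x - v₁ x) x = G v₀ x - G v₁ x := by
      simp only [hG, mul_sub, Finset.sum_sub_distrib]
    -- The sum and difference of the two halves of `v` diagonalise the noise on the first bit,
    -- multiplying `a` by `1` or `2 * q - 1`. The new endpoints lie between the old ones, so the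
    -- bounds persist.
    have hmid : |a * (2 * q - 1) - c| ≤ b := by
      have e1 : a * (2 * q - 1) ^ (n + 1) ≤ a * (2 * q - 1) :=
        mul_le_mul_of_nonneg_left (pow_le_of_le_one hθ0 hθ1 n.succ_ne_zero) ha
      have e2 : a * (2 * q - 1) ≤ a := mul_le_of_le_one_right ha hθ1
      rw [abs_le] at *
      constructor <;> linarith
    have hpow : |a * (2 * q - 1) ^ n - c| ≤ b := by
      have e1 : a * (2 * q - 1) ^ (n + 1) ≤ a * (2 * q - 1) ^ n :=
        mul_le_mul_of_nonneg_left (pow_le_pow_of_le_one hθ0 hθ1 n.le_succ) ha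
      have e2 : a * (2 * q - 1) ^ n ≤ a := mul_le_of_le_one_right ha (pow_le_one₀ hθ0 hθ1)
      rw [abs_le] at *
      constructor <;> linarith
    have hplus := ih ha h1 hpow fun x => v₀ x + v₁ x
    have hminus := ih (mul_nonneg ha hθ0) hmid (by rwa [mul_assoc, ← pow_succ'])
      fun x => v₀ x - v₁ x
    have h01 : (0 - 1 : ZMod 2) = 1 := by decide
    have hsplit (x : Fin n → ZMod 2) (e : ZMod 2) :
        ∑ y, (∏ i, bitNoise q ((Fin.cons e x : Fin (n + 1) → ZMod 2) i - y i)) * v y =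
          bitNoise q (e - 0) * G v₀ x + bitNoise q (e - 1) * G v₁ x := by
      simp only [sum_pi_succ, ZMod.sum_two, Fin.prod_univ_succ, Fin.cons_zero, Fin.cons_succ,
        hG, hv₀, hv₁, mul_assoc, ← Finset.mul_sum]
    change ∑ x, (a * G (fun x => v₀ x + v₁ x) x - c * (v₀ x + v₁ x)) ^ 2 ≤ _ at hplus
    change ∑ x, (a * (2 * q - 1) * G (fun x => v₀ x - v₁ x) x - c * (v₀ x - v₁ x)) ^ 2 ≤ _
      at hminus
    simp only [hadd] at hplus
    simp only [hsub] at hminus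
    rw [sum_pi_succ, sum_pi_succ n (fun x => v x ^ 2), ZMod.sum_two, ZMod.sum_two,
      ← Finset.sum_add_distrib, ← Finset.sum_add_distrib]
    simp only [hsplit, h01, sub_self, sub_zero, bitNoise_zero, bitNoise_one]
    have hL : ∑ x, ((a * (q * G v₀ x + (1 - q) * G v₁ x) - c * v₀ x) ^ 2 +
        (a * ((1 - q) * G v₀ x + q * G v₁ x) - c * v₁ x) ^ 2) =
        (∑ x, (a * (G v₀ x + G v₁ x) - c * (v₀ x + v₁ x)) ^ 2 +
          ∑ x, (a * (2 * q - 1) * (G v₀ x - G v₁ x) - c * (v₀ x - v₁ x)) ^ 2) / 2 := by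
      rw [← Finset.sum_add_distrib, Finset.sum_div]
      exact Finset.sum_congr rfl fun x _ => by ring
    have hR : ∑ x, (v₀ x ^ 2 + v₁ x ^ 2) =
        (∑ x, (v₀ x + v₁ x) ^ 2 + ∑ x, (v₀ x - v₁ x) ^ 2) / 2 := by
      rw [← Finset.sum_add_distrib, Finset.sum_div]
      exact Finset.sum_congr rfl fun x _ => by ring
    change ∑ x, ((a * (q * G v₀ x + (1 - q) * G v₁ x) - c * v₀ x) ^ 2 +
        (a * ((1 - q) * G v₀ x + q * G v₁ x) - c * v₁ x) ^ 2) ≤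
        b ^ 2 * ∑ x, (v₀ x ^ 2 + v₁ x ^ 2)
    rw [hL, hR]
    linarith

/-- The signed matrix is `2^(-n) (T - 2 q^n I)` with `T` the noise operator, since strings agree
with probability `q^n`. -/
theorem hasOpBound_eqFun_noisyPair {q : ℝ} (hq0 : 1 / 2 ≤ q) (hq1 : q ≤ 1) (n : ℕ) :
    HasOpBound (fun x y => bitSign (eqFun n x y) * prodPow (noisyPair q) n (x, y))
      (max |1 - 2 * q ^ n| |(2 * q - 1) ^ n - 2 * q ^ n| / Fintype.card (Fin n → ZMod 2)) := by
  intro v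
  have hcard : (Fintype.card (Fin n → ZMod 2) : ℝ) = 2 ^ n := by simp
  have h (x : Fin n → ZMod 2) :
      ∑ y, bitSign (eqFun n x y) * prodPow (noisyPair q) n (x, y) * v y =
        (1 * ∑ y, (∏ i, bitNoise q (x i - y i)) * v y - 2 * q ^ n * v x) / 2 ^ n := by
    have h' (y) : bitSign (eqFun n x y) * prodPow (noisyPair q) n (x, y) * v y =
        ((∏ i, bitNoise q (x i - y i)) * v y - if x = y then 2 * q ^ n * v y else 0) / 2 ^ n := by
      have hprod : prodPow (noisyPair q) n (x, y) = (∏ i, bitNoise q (x i - y i)) / 2 ^ n := by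
        simp [prodPow, noisyPair, Finset.prod_div_distrib]
      rw [hprod]
      unfold eqFun
      split_ifs with hxy
      · subst hxy
        simp
        ring
      · simp
        ring
    simp only [h', ← Finset.sum_div, Finset.sum_sub_distrib, Finset.sum_ite_eq, Finset.mem_univ,
      if_true, one_mul]
  simp only [h, hcard, div_pow, ← Finset.sum_div]
  rw [div_mul_eq_mul_div]
  gcongr
  exact sum_noise_sub_sq_le hq0 hq1 n zero_le_one (le_max_left _ _)
    (by rw [one_mul]; exact le_max_right _ _) v

end SpectralBounds

/-! ### Asymptotics of the norms. -/

section Asymptotics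

theorem eventually_eq_one_or_le {ρ : ℝ} (hρ1 : ρ ≤ 1) :
    ∀ᶠ n : ℕ in atTop, ρ = 1 ∨ ρ ≤ 1 - 2 * (1 / 2) ^ n := by
  rcases hρ1.eq_or_lt with h | h
  · exact Eventually.of_forall fun _ => Or.inl h
  · have hlim : Tendsto (fun n : ℕ => 1 - 2 * (1 / 2 : ℝ) ^ n) atTop (𝓝 (1 - 2 * 0)) :=
      (tendsto_pow_atTop_nhds_zero_of_lt_one (by norm_num) (by norm_num)).const_mul 2
        |>.const_sub 1
    rw [mul_zero, sub_zero] at hlim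
    exact (hlim.eventually_const_lt h).mono fun n hn => Or.inr hn.le

/-- For `q = 1 + log p / n` one has `2 q - 1 = 1 + 2 log p / n`, so the `n`-th powers tend to `p`
and `p²`. -/
theorem tendsto_noise_norm {p : ℝ} (hp : 0 < p) :
    Tendsto (fun n : ℕ => max |1 - 2 * (1 + Real.log p / n) ^ n|
      |(2 * (1 + Real.log p / n) - 1) ^ n - 2 * (1 + Real.log p / n) ^ n|) atTop
      (𝓝 (max |1 - 2 * p| |p ^ 2 - 2 * p|)) := by
  have h1 : Tendsto (fun n : ℕ => (1 + Real.log p / n) ^ n) atTop (𝓝 p) := by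
    simpa [Real.exp_log hp] using Real.tendsto_one_add_div_pow_exp (Real.log p)
  have h2 : Tendsto (fun n : ℕ => (2 * (1 + Real.log p / n) - 1) ^ n) atTop (𝓝 (p ^ 2)) := by
    have h := Real.tendsto_one_add_div_pow_exp (2 * Real.log p)
    rw [two_mul, Real.exp_add, Real.exp_log hp, ← sq, ← two_mul] at h
    refine h.congr fun n => ?_
    ring
  exact ((h1.const_mul 2).const_sub 1).abs.max (h2.sub (h1.const_mul 2)).abs

theorem two_mul_sqrt_three_sub_three_eq : 2 * √3 - 3 = (1 + 2 / √3)⁻¹ := by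
  have h3 : √3 * √3 = 3 := Real.mul_self_sqrt (by norm_num)
  have h0 : 0 < √3 := by positivity
  refine eq_inv_of_mul_eq_one_left ?_
  field_simp
  nlinarith

end Asymptotics

/-! ### The two lower bounds. -/

theorem theorem1 (ρ : ℝ) (hρ0 : 0 < ρ) (hρ1 : ρ ≤ 1) :
    (∃ (M : ℕ → ℕ → ℝ) (L : ℕ → ℝ) (A : EReal),
      (∀ n ℓ : ℕ, IsGreatest
        {c : ℝ | ∃ μ ∈ stdSimplex ℝ ((Fin n → ZMod 2) × (Fin n → ZMod 2)),
          c = 1 / (ℓ : ℝ) *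
            (distComplexity (ρ ^ ℓ) (xorPow (eqFun n) ℓ) (prodPow μ ℓ) : ℝ)}
        (M n ℓ)) ∧
      (∀ n : ℕ, Tendsto (fun ℓ : ℕ => M n ℓ) atTop (𝓝 (L n))) ∧
      Tendsto (fun n : ℕ => (L n : EReal)) atTop (𝓝 A) ∧
      ((2 * Real.logb 2 3 + 2 * Real.logb 2 ρ : ℝ) : EReal) ≤ A) ∧
    (∃ (M : ℕ → ℕ → ℝ) (L : ℕ → ℝ) (A : EReal),
      (∀ n ℓ : ℕ, IsGreatest
        {c : ℝ | ∃ ν ∈ stdSimplex ℝ (ZMod 2 × ZMod 2),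
          c = 1 / (ℓ : ℝ) *
            (distComplexity (ρ ^ ℓ) (xorPow (eqFun n) ℓ) (prodPow (prodPow ν n) ℓ) : ℝ)}
        (M n ℓ)) ∧
      (∀ n : ℕ, Tendsto (fun ℓ : ℕ => M n ℓ) atTop (𝓝 (L n))) ∧
      Tendsto (fun n : ℕ => (L n : EReal)) atTop (𝓝 A) ∧
      ((2 * Real.logb 2 (1 + 2 / Real.sqrt 3) + 2 * Real.logb 2 ρ : ℝ) : EReal) ≤ A) := by
  classical
  constructor
  · refine exists_iterated_limit_max_distComplexity hρ0.le hρ1 eqFun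
      (D := fun _ μ => μ)
      (b := fun n => 2 * Real.logb 2 ρ - 2 * Real.logb 2 (1 / 3 + 2 / 3 / ((2 : ℝ) ^ n - 1)))
      (fun n => ⟨_, single_mem_stdSimplex ℝ 0⟩) (fun n μ hμ => hμ)
      (Eventually.of_forall fun n μ hμ => ?_) ?_ ?_
    · obtain ⟨μ', hμ', h⟩ := exists_distComplexity_eqFun_succ_le hμ
      exact ⟨μ', hμ', fun ℓ => h _ (pow_le_one₀ hρ0.le hρ1) ℓ⟩
    · have h1 : Tendsto (fun n : ℕ => (1 / 3 : ℝ) + 2 / 3 / ((2 : ℝ) ^ n - 1)) atTop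
          (𝓝 (1 / 3 + 0)) := by
        refine Tendsto.const_add _ (Tendsto.const_div_atTop ?_ _)
        exact tendsto_atTop_add_const_right _ _
          (tendsto_pow_atTop_atTop_of_one_lt (by norm_num))
      have h2 := ((Real.continuousAt_logb (b := 2) (by norm_num)).tendsto.comp h1).const_mul 2
        |>.const_sub (2 * Real.logb 2 ρ)
      have hB : 2 * Real.logb 2 3 + 2 * Real.logb 2 ρ =
          2 * Real.logb 2 ρ - 2 * Real.logb 2 (1 / 3 + 0) := by
        rw [add_zero, one_div, Real.logb_inv]
        ring
      rw [hB]
      exact h2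
    · filter_upwards [eventually_ne_atTop 0] with n hn
      obtain ⟨μ, hμ, h⟩ := exists_hasOpBound_eqFun hn
      have hpos : (0 : ℝ) < 2 ^ n - 1 := sub_pos.2 (one_lt_pow₀ (by norm_num) hn)
      exact ⟨μ, hμ, fun ℓ hℓ => le_distComplexity_xorPow hμ (by positivity) hρ0 hρ1 h hℓ⟩
  · have h3 : √3 * √3 = 3 := Real.mul_self_sqrt (by norm_num)
    have h32 : √3 < 2 := by nlinarith [Real.sqrt_nonneg 3]
    have h31 : 3 / 2 < √3 := by nlinarith [Real.sqrt_nonneg 3]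
    -- `2 - √3` is the root of `p² - 4p + 1` in `(0, 1)`, where `p² - 2p = -(1 - 2p)`: both spectral
    -- ends have equal absolute value.
    have hp : 0 < 2 - √3 := by linarith
    have hlim := tendsto_noise_norm hp
    have hval : max |1 - 2 * (2 - √3)| |(2 - √3) ^ 2 - 2 * (2 - √3)| = (1 + 2 / √3)⁻¹ := by
      have e : (2 - √3) ^ 2 - 2 * (2 - √3) = -(1 - 2 * (2 - √3)) := by nlinarith
      rw [e, abs_neg, max_self, abs_of_pos (by linarith), ← two_mul_sqrt_three_sub_three_eq]
      ring
    rw [hval] at hlim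
    have hpos : 0 < (1 + 2 / √3)⁻¹ := by positivity
    refine exists_iterated_limit_max_distComplexity hρ0.le hρ1 eqFun
      (D := fun n ν => prodPow ν n)
      (b := fun n => 2 * Real.logb 2 ρ - 2 * Real.logb 2
        (max |1 - 2 * (1 + Real.log (2 - √3) / n) ^ n|
          |(2 * (1 + Real.log (2 - √3) / n) - 1) ^ n - 2 * (1 + Real.log (2 - √3) / n) ^ n|))
      (fun n => ⟨_, single_mem_stdSimplex ℝ 0⟩) (fun n ν hν => prodPow_mem_stdSimplex hν n)
      ((eventually_eq_one_or_le hρ1).mono fun n hn ν hν =>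
        exists_prodPow_distComplexity_le hρ0.le hρ1 hn hν) ?_ ?_
    · have h2 := ((Real.continuousAt_logb (b := 2) hpos.ne').tendsto.comp hlim).const_mul 2
        |>.const_sub (2 * Real.logb 2 ρ)
      have hB : 2 * Real.logb 2 (1 + 2 / √3) + 2 * Real.logb 2 ρ =
          2 * Real.logb 2 ρ - 2 * Real.logb 2 (1 + 2 / √3)⁻¹ := by
        rw [Real.logb_inv]
        ring
      rw [hB]
      exact h2
    · have hq : Tendsto (fun n : ℕ => 1 + Real.log (2 - √3) / n) atTop (𝓝 (1 + 0)) :=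
        (tendsto_const_div_atTop_nhds_zero_nat _).const_add 1
      rw [add_zero] at hq
      filter_upwards [hlim.eventually_const_lt hpos,
        hq.eventually_const_lt (by norm_num : (1 / 2 : ℝ) < 1)] with n hn hqn
      have hq1 : 1 + Real.log (2 - √3) / n ≤ 1 := by
        have : Real.log (2 - √3) / n ≤ 0 :=
          div_nonpos_of_nonpos_of_nonneg (Real.log_nonpos hp.le (by linarith)) n.cast_nonneg
        linarith
      refine ⟨noisyPair _, noisyPair_mem_stdSimplex (by linarith) hq1, fun ℓ hℓ => ?_⟩
      exact le_distComplexity_xorPow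
        (prodPow_mem_stdSimplex (noisyPair_mem_stdSimplex (by linarith) hq1) n) hn hρ0 hρ1
        (hasOpBound_eqFun_noisyPair hqn.le hq1 n) hℓ
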